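/- Consider a time-slotted network with integer capacity $C$ per slot. In slot $n$, $Q^p(n)$ primary and $Q^s(n)$ secondary requests arrive; all these variables are independent, Poisson with means $\lambda^p$ and $\lambda^s$ respectively. The primary requests are predicted one slot ahead ($T=1$): those arriving in slot $n$ may be served in slot $n$ or $n+1$. The secondary requests must be served in their slot of arrival. Let $N_0^p(n)\ge 0$ be the amount of primary requests in the network at the beginning of slot $n$ that expire in slot $n$; its initial value is independent of all arrivals. The primary network uses the dynamic capacity policy with $f=\tfrac12$: in slot $n$ it serves the (possibly fractional) amount $$C^p(n)=\min\{C,\;N_0^p(n)+\tfrac12 Q^p(n)\}$$ of primary requests, earliest deadline first, and requests that are unserved at their deadline are dropped, so that $$N_0^p(n+1)=\begin{cases}Q^p(n), & N_0^p(n)\ge C,\\ Q^p(n)+N_0^p(n)-C, & N_0^p(n)<C\le N_0^p(n)+\tfrac12Q^p(n),\\ \tfrac12Q^p(n), & N_0^p(n)+\tfrac12Q^p(n)<C.\end{cases}$$ Suppose that for every $C$ the Markov chain $N_0^p$ is at a stationary distribution, and let $$P_C=P\bigl(Q^s(n)+C^p(n)>C,\ Q^s(n)>0\bigr)$$ be the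 secondary outage probability. (i) Linear regime. Let $\lambda^p=\gamma^pC$, $\lambda^s=\gamma^sC$ with $0<\gamma^s<\gamma^p$ and $\gamma^p+\gamma^s<1$. Then the secondary diversity gain $d=\lim_{C\to\infty}-\frac{\log P_C}{C}$ exists and $$d\ \ge\ -\gamma^s(y^2-1)-2\gamma^p(y-1)+2\log y,\qquad y=-\frac{\gamma^p}{2\gamma^s}+\frac{\sqrt{4\gamma^s+(\gamma^p)^2}}{2\gamma^s}.$$ (ii) Polynomial regime. Let $\lambda^p=C^{\gamma^p}$, $\lambda^s=C^{\gamma^s}$ with $0<\gamma^s<\gamma^p<1$. Then the secondary diversity gain $d=\lim_{C\to\infty}-\frac{\log P_C}{C\log C}$ exists and $$d\ \ge\ \begin{cases}1-\gamma^s, & 1+\gamma^s\ge 2\gamma^p,\\ 2(1-\gamma^p), & 1+\gamma^s<2\gamma^p.\end{cases}$$ The limits depend only on $(\gamma^p,\gamma^s)$, not on $n$ or on the choice of the stationary distribution. -/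

import Mathlib

open MeasureTheory ProbabilityTheory Filter Topology
open scoped NNReal

universe u

namespace ProactiveNetwork

/-- Number of primary requests served in a slot under dynamic capacity assignment:
`min {C, N₀ + f (N₁ + ⋯ + N_T)}`, where `x i` is the amount `N_i` of primary requests that are in
the network at the beginning of the slot (arrivals included) with deadline `i` slots ahead. -/
noncomputable def primaryCapacity {T : ℕ} (f : ℝ) (C : ℕ) (x : Fin (T + 1) → ℝ) : ℝ :=
  min (C : ℝ) (x 0 + f * ∑ i : Fin T, x i.succ)

/-- Amount served of the requests with deadline `i` slots ahead, when a total service `c` is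
spent by earliest deadline first. -/
noncomputable def edfServed {T : ℕ} (c : ℝ) (x : Fin (T + 1) → ℝ) (i : Fin (T + 1)) : ℝ :=
  min (x i) (max 0 (c - ∑ j ∈ Finset.Iio i, x j))

/-- The primary backlog `(N₀(n), …, N_T(n))` at the beginning of slot `n`. The requests predicted
in slot `n` enter with deadline `n + T`, so `N_T(n) = q n`. Unserved requests move one slot closer
to their deadline, and those that are unserved at their deadline are dropped. The vector `x₀`
is `(N₀(0), …, N_{T-1}(0))`. -/
noncomputable def backlog {T : ℕ} (f : ℝ) (C : ℕ) (x₀ : Fin T → ℝ) (q : ℕ → ℕ) :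
    ℕ → Fin (T + 1) → ℝ
  | 0 => Fin.snoc (α := fun _ => ℝ) x₀ (q 0 : ℝ)
  | n + 1 => Fin.snoc (α := fun _ => ℝ)
      (fun i : Fin T => backlog f C x₀ q n i.succ -
        edfServed (primaryCapacity f C (backlog f C x₀ q n)) (backlog f C x₀ q n) i.succ)
      (q (n + 1) : ℝ)

/-- The random input of a network with prediction window `T`: primary and secondary arrivals,
all independent and Poisson with means `lp` and `ls` per slot, and an initial primary backlog
independent of the arrivals. -/
structure Traffic (T : ℕ) (lp ls : ℝ≥0) where
  Ω : Type u
  [measurableSpace : MeasurableSpace Ω]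
  μ : Measure Ω
  [isProbabilityMeasure : IsProbabilityMeasure μ]
  primary : ℕ → Ω → ℕ
  secondary : ℕ → Ω → ℕ
  initial : Ω → Fin T → ℝ
  measurable_primary : ∀ n, Measurable (primary n)
  measurable_secondary : ∀ n, Measurable (secondary n)
  measurable_initial : Measurable initial
  initial_nonneg : ∀ ω i, 0 ≤ initial ω i
  law_primary : ∀ n, μ.map (primary n) = poissonMeasure lp
  law_secondary : ∀ n, μ.map (secondary n) = poissonMeasure ls
  indep_arrivals : iIndepFun (Sum.elim primary secondary) μ
  indep_initial : IndepFun initial (fun ω => (fun n => primary n ω, fun n => secondary n ω)) μ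

attribute [instance] Traffic.measurableSpace Traffic.isProbabilityMeasure

namespace Traffic

variable {T : ℕ} {lp ls : ℝ≥0}

/-- `N_i(n)` for the primary network with capacity `C` and cooperation parameter `f`. -/
noncomputable def primaryBacklog (S : Traffic.{u} T lp ls) (f : ℝ) (C n : ℕ) (i : Fin (T + 1))
    (ω : S.Ω) : ℝ :=
  backlog f C (S.initial ω) (fun k => S.primary k ω) n i

/-- The process `N₀(n)`, the amount of primary requests that expire in slot `n`, is at its
stationary distribution: its law is the same in every slot. -/
def IsStationary (S : Traffic.{u} T lp ls) (f : ℝ) (C : ℕ) : Prop :=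
  ∀ n, S.μ.map (S.primaryBacklog f C n 0) = S.μ.map (S.primaryBacklog f C 0 0)

/-- Probability of a secondary outage in slot `n`: some secondary request arrives, and the
secondary arrivals exceed the capacity that is left by the primary network. -/
noncomputable def secondaryOutage (S : Traffic.{u} T lp ls) (f : ℝ) (C n : ℕ) : ℝ :=
  S.μ.real {ω | (C : ℝ) < (S.secondary n ω : ℝ) +
      primaryCapacity f C (fun i => S.primaryBacklog f C n i ω) ∧ 0 < S.secondary n ω}

end Traffic

/-- `d` is the secondary diversity gain in the linear regime `λᵖ = γp C`, `λˢ = γs C`: the limit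
of `-log P / C` for the stationary secondary outage probability `P` as `C → ∞`. -/
def IsLinearSecondaryGain (T : ℕ) (f γp γs d : ℝ) : Prop :=
  ∀ S : (C : ℕ) → Traffic.{u} T (Real.toNNReal (γp * C)) (Real.toNNReal (γs * C)),
    (∀ C, (S C).IsStationary f C) →
      ∀ n, Tendsto (fun C : ℕ => -Real.log ((S C).secondaryOutage f C n) / C) atTop (𝓝 d)

/-- `d` is the secondary diversity gain in the polynomial regime `λᵖ = C ^ γp`, `λˢ = C ^ γs`:
the limit of `-log P / (C log C)` for the stationary secondary outage probability `P`. -/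
def IsPolynomialSecondaryGain (T : ℕ) (f γp γs d : ℝ) : Prop :=
  ∀ S : (C : ℕ) → Traffic.{u} T (Real.toNNReal ((C : ℝ) ^ γp)) (Real.toNNReal ((C : ℝ) ^ γs)),
    (∀ C, (S C).IsStationary f C) →
      ∀ n, Tendsto (fun C : ℕ => -Real.log ((S C).secondaryOutage f C n) / (C * Real.log C))
        atTop (𝓝 d)

/-- The positive root of `γs y² + γp y = 1`. -/
noncomputable def linearRoot (γp γs : ℝ) : ℝ :=
  -(γp / (2 * γs)) + √(4 * γs + γp ^ 2) / (2 * γs)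

end ProactiveNetwork

/-! The stated bounds are in fact the exact gains, found by matching two estimates. After an
uncongested slot exactly half of its arrivals are carried over, so an outage then needs two slots of
primary arrivals `q`, `q'` and secondary arrivals `s` with `2s + q + q' ≥ 2C`. Otherwise follow the
congestion back in time (`overload_cases`): either it began within `K` slots, which needs `q + q' ≥
2C` for some earlier pair, or it lasted all `K` slots, which needs about `K C` arrivals. The
Chernoff exponent of the last event grows with `K`, so a fixed large `K` makes it harmless, and the
first event dictates the rate (`Traffic.secondaryOutage_le`).

Conversely, at least half of the arrivals are always carried over, so `b` primary arrivals in two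
consecutive slots and `a` secondary ones in the second, with `a + b > C`, force an outage
(`Traffic.le_secondaryOutage`). Stationarity allows each estimate to be made in a convenient slot.
`tendsto_neg_log_secondaryOutage` squeezes the gain; each regime then only chooses `t`, `K`, `a` and
`b`. -/

namespace ProactiveNetwork

/-! ### Backlog recursion and overload events -/

section Dynamics

variable {C : ℕ} {x₀ : Fin 1 → ℝ} {q : ℕ → ℕ}

lemma backlog_one (f : ℝ) (C : ℕ) (x₀ : Fin 1 → ℝ) (q : ℕ → ℕ) (n : ℕ) :
    backlog f C x₀ q n 1 = q n := by
  cases n <;> exact Fin.snoc_last (α := fun _ => ℝ) _ _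

lemma backlog_zero_zero (f : ℝ) (C : ℕ) (x₀ : Fin 1 → ℝ) (q : ℕ → ℕ) :
    backlog f C x₀ q 0 0 = x₀ 0 :=
  Fin.snoc_castSucc (α := fun _ => ℝ) (q 0 : ℝ) x₀ 0

/-- The expiring amount in the next slot, from the expiring amount `ν` and the arrivals `k`. -/
noncomputable def nextBacklog (f : ℝ) (C : ℕ) (ν k : ℝ) : ℝ :=
  k - min k (max 0 (min (C : ℝ) (ν + f * k) - ν))

lemma primaryCapacity_backlog (f : ℝ) (C : ℕ) (x₀ : Fin 1 → ℝ) (q : ℕ → ℕ) (n : ℕ) :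
    primaryCapacity f C (backlog f C x₀ q n) = min (C : ℝ) (backlog f C x₀ q n 0 + f * q n) := by
  simp [primaryCapacity, backlog_one]

lemma backlog_succ_zero (f : ℝ) (C : ℕ) (x₀ : Fin 1 → ℝ) (q : ℕ → ℕ) (n : ℕ) :
    backlog f C x₀ q (n + 1) 0 = nextBacklog f C (backlog f C x₀ q n 0) (q n) := by
  have h : backlog f C x₀ q (n + 1) 0 = backlog f C x₀ q n 1 -
        edfServed (primaryCapacity f C (backlog f C x₀ q n)) (backlog f C x₀ q n) 1 :=
    Fin.snoc_castSucc (α := fun _ => ℝ) (q (n + 1) : ℝ) (fun i : Fin 1 => backlog f C x₀ q n i.succ -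
        edfServed (primaryCapacity f C (backlog f C x₀ q n)) (backlog f C x₀ q n) i.succ) 0
  have h1 : Finset.Iio (1 : Fin 2) = {0} := by decide
  rw [h, primaryCapacity_backlog, edfServed, h1, Finset.sum_singleton, backlog_one, nextBacklog]

lemma nextBacklog_nonneg (f : ℝ) (C : ℕ) (ν k : ℝ) : 0 ≤ nextBacklog f C ν k :=
  sub_nonneg.2 (min_le_left _ _)

lemma nextBacklog_le (f : ℝ) (C : ℕ) (ν : ℝ) {k : ℝ} (hk : 0 ≤ k) : nextBacklog f C ν k ≤ k :=
  sub_le_self _ (le_min hk (le_max_left _ _))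

/-- Service never exceeds `ν + k / 2` and the expiring `ν` goes first. No condition on `ν` is
needed, so the outage lower bound ignores the stationary law. -/
lemma half_le_nextBacklog (C : ℕ) (ν : ℝ) {k : ℝ} (hk : 0 ≤ k) :
    k / 2 ≤ nextBacklog (1 / 2) C ν k := by
  have : min k (max 0 (min (C : ℝ) (ν + 1 / 2 * k) - ν)) ≤ k / 2 := by
    refine (min_le_right _ _).trans (max_le (by linarith) ?_)
    linarith [min_le_right (C : ℝ) (ν + 1 / 2 * k)]
  rw [nextBacklog]
  linarith

/-- If the network is not congested, then half of the new arrivals are served in advance. -/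
lemma nextBacklog_of_lt {ν k : ℝ} (hk : 0 ≤ k) (h : ν + k / 2 < C) :
    nextBacklog (1 / 2) C ν k = k / 2 := by
  rw [nextBacklog, min_eq_right (a := (C : ℝ)) (by linarith), max_eq_right (by linarith),
    min_eq_right (by linarith)]
  ring

/-- In a congested slot the total amount served is the capacity. -/
lemma nextBacklog_le_of_le {ν k : ℝ} (hk : 0 ≤ k) (h : C ≤ ν + k / 2) :
    nextBacklog (1 / 2) C ν k ≤ ν + k - C := by
  rw [nextBacklog, min_eq_left (a := (C : ℝ)) (by linarith)]
  have : (C : ℝ) - ν ≤ min k (max 0 (C - ν)) := le_min (by linarith) (le_max_right _ _)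
  linarith

lemma backlog_nonneg (f : ℝ) (C : ℕ) (hx : ∀ i, 0 ≤ x₀ i) (n : ℕ) :
    0 ≤ backlog f C x₀ q n 0 := by
  cases n with
  | zero => rw [backlog_zero_zero]; exact hx 0
  | succ n => rw [backlog_succ_zero]; exact nextBacklog_nonneg _ _ _ _

/-- Along congested slots the backlog is at most the arrivals less the total capacity. -/
lemma backlog_le_sum_of_congested (K : ℕ)
    (h : ∀ j, 1 ≤ j → j ≤ K → (C : ℝ) ≤ backlog (1 / 2) C x₀ q j 0 + q j / 2) :
    backlog (1 / 2) C x₀ q (K + 1) 0 ≤ ∑ i ∈ Finset.range (K + 1), (q i : ℝ) - K * C := by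
  induction K with
  | zero => simpa [backlog_succ_zero] using nextBacklog_le (1 / 2) C _ (Nat.cast_nonneg (q 0))
  | succ K ih =>
    have h1 := ih fun j h1 h2 => h j h1 (by omega)
    have h2 := nextBacklog_le_of_le (Nat.cast_nonneg _) (h (K + 1) (by omega) le_rfl)
    rw [backlog_succ_zero, Finset.sum_range_succ]
    push_cast
    linarith

/-- A network overload is caused by two consecutive slots with many arrivals, or by many arrivals
over the whole past. -/
lemma overload_cases (hx : ∀ i, 0 ≤ x₀ i) (K : ℕ) {s : ℝ}
    (h : (C : ℝ) < s + backlog (1 / 2) C x₀ q (K + 1) 0 + q (K + 1) / 2) :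
    2 * (C : ℝ) ≤ 2 * s + q K + q (K + 1) ∨
      (∃ j ∈ Finset.range K, 2 * (C : ℝ) ≤ q j + q (j + 1)) ∨
      (K : ℝ) * C ≤ ∑ i ∈ Finset.range (K + 1), (q i : ℝ) := by
  by_cases hK : ∀ j, 1 ≤ j → j ≤ K → (C : ℝ) ≤ backlog (1 / 2) C x₀ q j 0 + q j / 2
  · have h1 := backlog_le_sum_of_congested K hK
    have h2 := backlog_nonneg (q := q) (1 / 2) C hx (K + 1)
    exact Or.inr (Or.inr (by linarith))
  -- Once some slot is uncongested, the next congested slot `m + 1` starts with backlog `q m / 2`,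
  -- so its congestion means `q m + q (m + 1) ≥ 2C`.
  · have key : ∀ m, m ≤ K → (∃ j, 1 ≤ j ∧ j ≤ m ∧ backlog (1 / 2) C x₀ q j 0 + q j / 2 < C) →
        (∃ j ∈ Finset.range m, 2 * (C : ℝ) ≤ q j + q (j + 1)) ∨
          backlog (1 / 2) C x₀ q m 0 + q m / 2 < C := by
      intro m hm
      induction m with
      | zero => rintro ⟨j, h1, h2, -⟩; omega
      | succ m ih =>
        rintro ⟨j, h1, h2, h3⟩
        rcases Nat.lt_or_ge m j with hj | hj
        · obtain rfl : j = m + 1 := by omega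
          exact Or.inr h3
        · rcases ih (by omega) ⟨j, h1, hj, h3⟩ with ⟨i, hi, h4⟩ | h4
          · exact Or.inl ⟨i, by simp at hi ⊢; omega, h4⟩
          · by_cases h5 : backlog (1 / 2) C x₀ q (m + 1) 0 + q (m + 1) / 2 < C
            · exact Or.inr h5
            · rw [backlog_succ_zero, nextBacklog_of_lt (Nat.cast_nonneg _) h4] at h5
              exact Or.inl ⟨m, by simp, by linarith⟩
    push Not at hK
    rcases key K le_rfl hK with h1 | h1
    · exact Or.inr (Or.inl h1)
    · rw [backlog_succ_zero, nextBacklog_of_lt (Nat.cast_nonneg _) h1] at h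
      exact Or.inl (by linarith)

end Dynamics

/-! ### Regrouping of independent variables -/

section Independence

variable {Ω α β γ : Type*} {mΩ : MeasurableSpace Ω} [MeasurableSpace α] [MeasurableSpace β]
  [MeasurableSpace γ] {μ : Measure Ω} [IsProbabilityMeasure μ]

lemma indepFun_prodMk_of_indepFun_prodMk {X : Ω → α} {A : Ω → β} {B : Ω → γ} (hX : Measurable X)
    (hA : Measurable A) (hB : Measurable B) (h : IndepFun X (fun ω => (A ω, B ω)) μ)
    (hAB : IndepFun A B μ) : IndepFun (fun ω => (X ω, A ω)) B μ := by
  have := Measure.isProbabilityMeasure_map (μ := μ) hX.aemeasurable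
  have := Measure.isProbabilityMeasure_map (μ := μ) hA.aemeasurable
  have := Measure.isProbabilityMeasure_map (μ := μ) hB.aemeasurable
  have hXA : IndepFun X A μ := h.comp measurable_id measurable_fst
  have e1 := h.map_prod_eq_prod_map_map hX.aemeasurable (hA.prodMk hB).aemeasurable
  rw [hAB.map_prod_eq_prod_map_map hA.aemeasurable hB.aemeasurable] at e1
  rw [indepFun_iff_map_prod_eq_prod_map_map (hX.prodMk hA).aemeasurable hB.aemeasurable,
    hXA.map_prod_eq_prod_map_map hX.aemeasurable hA.aemeasurable]
  have e2 : μ.map (fun ω => ((X ω, A ω), B ω)) =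
      (μ.map (fun ω => (X ω, (A ω, B ω)))).map MeasurableEquiv.prodAssoc.symm := by
    rw [Measure.map_map (MeasurableEquiv.measurable _) (hX.prodMk (hA.prodMk hB))]
    rfl
  rw [e2, e1]
  exact ((measurePreserving_prodAssoc _ _ _).symm _).map_eq

end Independence

/-! ### Poisson moment generating function -/

section Poisson

lemma hasSum_exp_mul_poisson (r : ℝ≥0) (t : ℝ) :
    HasSum (fun n : ℕ => Real.exp (-r) * r ^ n / n.factorial * Real.exp (t * n))
      (Real.exp (r * (Real.exp t - 1))) := by
  have h := (NormedSpace.expSeries_div_hasSum_exp ((r : ℝ) * Real.exp t)).mul_left (Real.exp (-r))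
  rw [← Real.exp_eq_exp_ℝ, ← Real.exp_add] at h
  convert! h using 2 with n
  · rw [mul_pow, ← Real.exp_nat_mul, mul_comm t]
    ring
  · ring_nf

lemma integrable_exp_mul_poissonMeasure (r : ℝ≥0) (t : ℝ) :
    Integrable (fun n : ℕ => Real.exp (t * n)) (poissonMeasure r) := by
  rw [integrable_poissonMeasure_iff]
  simpa using (hasSum_exp_mul_poisson r t).summable

lemma mgf_poissonMeasure (r : ℝ≥0) (t : ℝ) :
    mgf (fun n : ℕ => (n : ℝ)) (poissonMeasure r) t = Real.exp (r * (Real.exp t - 1)) := by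
  rw [mgf, integral_poissonMeasure]
  exact (hasSum_exp_mul_poisson r t).tsum_eq

end Poisson

section BacklogFunction

lemma measurable_backlog (f : ℝ) (C n : ℕ) :
    Measurable fun p : (Fin 1 → ℝ) × (ℕ → ℕ) => backlog f C p.1 p.2 n 0 := by
  induction n with
  | zero =>
    simp only [backlog_zero_zero]
    fun_prop
  | succ n ih =>
    simp only [backlog_succ_zero, nextBacklog]
    fun_prop

/-- Causality: this makes the backlog a function of the initial value and finitely many past
arrivals, hence independent of the current ones. -/
lemma backlog_congr (f : ℝ) (C : ℕ) (x₀ : Fin 1 → ℝ) {q q' : ℕ → ℕ} {n : ℕ}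
    (h : ∀ i < n, q i = q' i) : backlog f C x₀ q n 0 = backlog f C x₀ q' n 0 := by
  induction n with
  | zero => simp only [backlog_zero_zero]
  | succ n ih =>
    rw [backlog_succ_zero, backlog_succ_zero, ih fun i hi => h i (by omega), h n (by omega)]

end BacklogFunction

/-! ### Probability bounds for the outage -/

namespace Traffic

variable {lp ls : ℝ≥0}

/-- The mean of an arrival variable. -/
def rate (lp ls : ℝ≥0) : ℕ ⊕ ℕ → ℝ≥0 := Sum.elim (fun _ => lp) (fun _ => ls)

lemma measurable_arrivals {T : ℕ} (S : Traffic.{u} T lp ls) (i : ℕ ⊕ ℕ) :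
    Measurable (Sum.elim S.primary S.secondary i) := by
  cases i
  · exact S.measurable_primary _
  · exact S.measurable_secondary _

lemma law_arrivals {T : ℕ} (S : Traffic.{u} T lp ls) (i : ℕ ⊕ ℕ) :
    S.μ.map (Sum.elim S.primary S.secondary i) = poissonMeasure (rate lp ls i) := by
  cases i
  · exact S.law_primary _
  · exact S.law_secondary _

/-- Chernoff bound for a weighted sum of arrivals. -/
lemma measureReal_le_sum_arrivals {T : ℕ} (S : Traffic.{u} T lp ls) (s : Finset (ℕ ⊕ ℕ))
    (w : ℕ ⊕ ℕ → ℝ) (B : ℝ) {t : ℝ} (ht : 0 ≤ t) :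
    S.μ.real {ω | B ≤ ∑ i ∈ s, w i * (Sum.elim S.primary S.secondary i ω : ℝ)} ≤
      Real.exp (-t * B + ∑ i ∈ s, rate lp ls i * (Real.exp (w i * t) - 1)) := by
  set X : ℕ ⊕ ℕ → S.Ω → ℝ := fun i ω => w i * (Sum.elim S.primary S.secondary i ω : ℝ)
  have hX : iIndepFun X S.μ :=
    S.indep_arrivals.comp (fun i (k : ℕ) => w i * (k : ℝ)) fun i => .of_discrete
  have hm : ∀ i, Measurable (X i) := fun i =>
    (Measurable.of_discrete (f := fun k : ℕ => w i * (k : ℝ))).comp (S.measurable_arrivals i)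
  have hint : ∀ i ∈ s, Integrable (fun ω => Real.exp (t * X i ω)) S.μ := by
    intro i _
    have h := integrable_exp_mul_poissonMeasure (rate lp ls i) (w i * t)
    rw [← S.law_arrivals i, integrable_map_measure .of_discrete
      (S.measurable_arrivals i).aemeasurable] at h
    convert h using 2 with ω
    simp only [X, Function.comp_apply]
    ring_nf
  have hmgf : ∀ i, mgf (X i) S.μ t = Real.exp (rate lp ls i * (Real.exp (w i * t) - 1)) := by
    intro i
    rw [mgf_const_mul, ← mgf_poissonMeasure, ← S.law_arrivals i,
      mgf_map (S.measurable_arrivals i).aemeasurable .of_discrete]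
    rfl
  have h := measure_ge_le_exp_mul_mgf B ht (hX.integrable_exp_mul_sum hm hint)
  rw [hX.mgf_sum hm, Finset.prod_congr rfl fun i _ => hmgf i, ← Real.exp_sum, ← Real.exp_add] at h
  simpa only [Finset.sum_apply] using h

section OneSlot

variable (S : Traffic.{u} 1 lp ls)

lemma measurable_primaryBacklog (f : ℝ) (C n : ℕ) : Measurable (S.primaryBacklog f C n 0) :=
  (measurable_backlog f C n).comp
    (S.measurable_initial.prodMk (measurable_pi_lambda _ S.measurable_primary))

/-- The backlog is independent of the arrivals of the current slot. -/
lemma indepFun_primaryBacklog (f : ℝ) (C n : ℕ) :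
    IndepFun (S.primaryBacklog f C n 0) (fun ω => (S.primary n ω, S.secondary n ω)) S.μ := by
  classical
  set Z := Sum.elim S.primary S.secondary
  let s : Finset (ℕ ⊕ ℕ) := (Finset.range n).image Sum.inl
  let e : Finset (ℕ ⊕ ℕ) := {Sum.inl n, Sum.inr n}
  have hse : Disjoint s e := by
    simp only [s, e, Finset.disjoint_left, Finset.mem_image, Finset.mem_range]
    rintro _ ⟨i, hi, rfl⟩
    simp [hi.ne]
  let A : S.Ω → s → ℕ := fun ω i => Z i ω
  have hA : Measurable A := measurable_pi_lambda _ fun i => S.measurable_arrivals _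
  have hB : Measurable fun ω => (S.primary n ω, S.secondary n ω) :=
    (S.measurable_primary n).prodMk (S.measurable_secondary n)
  have hAB : IndepFun A (fun ω => (S.primary n ω, S.secondary n ω)) S.μ :=
    (S.indep_arrivals.indepFun_finset s e hse S.measurable_arrivals).comp measurable_id
      (φ := id) (ψ := fun b : e → ℕ => (b ⟨Sum.inl n, by simp [e]⟩, b ⟨Sum.inr n, by simp [e]⟩))
      (by fun_prop)
  have hX : IndepFun S.initial (fun ω => (A ω, (S.primary n ω, S.secondary n ω))) S.μ := by
    refine S.indep_initial.comp (φ := id) (ψ := fun p : (ℕ → ℕ) × (ℕ → ℕ) =>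
      ((fun i : s => Sum.elim p.1 p.2 i.1), (p.1 n, p.2 n))) measurable_id ?_ |>.congr ?_ ?_
    · refine Measurable.prodMk (measurable_pi_lambda _ ?_) (by fun_prop)
      rintro ⟨i | i, hi⟩ <;> simp only [Sum.elim_inl, Sum.elim_inr] <;> fun_prop
    · rfl
    · refine Eventually.of_forall fun ω => Prod.ext (funext ?_) rfl
      rintro ⟨i | i, hi⟩ <;> rfl
  have key := indepFun_prodMk_of_indepFun_prodMk S.measurable_initial hA hB hX hAB
  -- Padding the finite past by zeros is harmless, since slots from `n` on do not affect the backlog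
  -- in slot `n`.
  let ext : (s → ℕ) → ℕ → ℕ := fun a i => if h : Sum.inl i ∈ s then a ⟨Sum.inl i, h⟩ else 0
  have hext : Measurable ext := by
    refine measurable_pi_lambda _ fun i => ?_
    by_cases h : Sum.inl i ∈ s <;> simp only [ext, h, dite_true, dite_false] <;> fun_prop
  refine (key.comp (φ := fun p : (Fin 1 → ℝ) × (s → ℕ) => backlog f C p.1 (ext p.2) n 0)
    (ψ := id) ((measurable_backlog f C n).comp (measurable_fst.prodMk
      (hext.comp measurable_snd))) measurable_id).congr ?_ ?_
  · refine Eventually.of_forall fun ω => backlog_congr f C _ fun i hi => ?_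
    have : Sum.inl i ∈ s := by simp [s, hi]
    simp only [ext, this, dite_true]
    rfl
  · rfl

lemma map_backlog_arrivals (f : ℝ) (C n : ℕ) :
    S.μ.map (fun ω => (S.primaryBacklog f C n 0 ω, (S.primary n ω, S.secondary n ω))) =
      (S.μ.map (S.primaryBacklog f C n 0)).prod ((poissonMeasure lp).prod (poissonMeasure ls)) := by
  have h : IndepFun (S.primary n) (S.secondary n) S.μ :=
    S.indep_arrivals.indepFun (i := Sum.inl n) (j := Sum.inr n) (by simp)
  rw [(S.indepFun_primaryBacklog f C n).map_prod_eq_prod_map_map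
    (S.measurable_primaryBacklog f C n).aemeasurable
    ((S.measurable_primary n).prodMk (S.measurable_secondary n)).aemeasurable,
    h.map_prod_eq_prod_map_map (S.measurable_primary n).aemeasurable
      (S.measurable_secondary n).aemeasurable, S.law_primary, S.law_secondary]

lemma secondaryOutage_eq_map (f : ℝ) (C n : ℕ) :
    S.secondaryOutage f C n =
      (S.μ.map (fun ω => (S.primaryBacklog f C n 0 ω, (S.primary n ω, S.secondary n ω)))).real
        {p : ℝ × ℕ × ℕ | (C : ℝ) < p.2.2 + min (C : ℝ) (p.1 + f * p.2.1) ∧ 0 < p.2.2} := by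
  rw [map_measureReal_apply]
  · simp only [secondaryOutage, primaryBacklog, primaryCapacity_backlog]
    rfl
  · exact (S.measurable_primaryBacklog f C n).prodMk
      ((S.measurable_primary n).prodMk (S.measurable_secondary n))
  · have h3 : Measurable fun p : ℝ × ℕ × ℕ => p.2.2 := by fun_prop
    have h4 : Measurable fun p : ℝ × ℕ × ℕ => (p.2.2 : ℝ) + min (C : ℝ) (p.1 + f * p.2.1) := by
      fun_prop
    exact (measurableSet_lt measurable_const h4).inter (measurableSet_lt measurable_const h3)

/-- In the stationary regime the secondary outage probability is the same in every slot. -/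
lemma secondaryOutage_eq {S : Traffic.{u} 1 lp ls} {f : ℝ} {C : ℕ} (hS : S.IsStationary f C)
    (m n : ℕ) : S.secondaryOutage f C m = S.secondaryOutage f C n := by
  rw [secondaryOutage_eq_map, secondaryOutage_eq_map, map_backlog_arrivals, map_backlog_arrivals,
    hS m, hS n]

/-- Lower bound of the outage probability by the point masses of the arrivals in the current and
the previous slot. -/
lemma le_secondaryOutage {S : Traffic.{u} 1 lp ls} {C : ℕ} (hS : S.IsStationary (1 / 2) C)
    (n : ℕ) {a b : ℕ} (ha : 0 < a) (hab : C < a + b) :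
    (poissonMeasure ls).real {a} * (poissonMeasure lp).real {b} ^ 2 ≤
      S.secondaryOutage (1 / 2) C n := by
  -- Slot 1 is the first whose backlog comes from actual arrivals.
  rw [secondaryOutage_eq hS n 1]
  let s : Finset (ℕ ⊕ ℕ) := {Sum.inl 0, Sum.inl 1, Sum.inr 1}
  let v : ℕ ⊕ ℕ → Set ℕ := Sum.elim (fun _ => {b}) (fun _ => {a})
  have h1 := S.indep_arrivals.measure_inter_preimage_eq_mul s (sets := v) fun _ _ => .of_discrete
  have h2 : ∀ i, S.μ (Sum.elim S.primary S.secondary i ⁻¹' v i) =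
      poissonMeasure (rate lp ls i) (v i) := by
    intro i
    rw [← S.law_arrivals i, Measure.map_apply (S.measurable_arrivals i) .of_discrete]
  simp only [h2] at h1
  have h3 : (poissonMeasure ls).real {a} * (poissonMeasure lp).real {b} ^ 2 =
      S.μ.real (⋂ i ∈ s, Sum.elim S.primary S.secondary i ⁻¹' v i) := by
    rw [measureReal_def, measureReal_def, measureReal_def, h1]
    simp [s, v, rate]
    ring
  rw [h3]
  refine measureReal_mono ?_
  intro ω hω
  simp only [s, v, Finset.mem_insert, Finset.mem_singleton, Set.iInter_iInter_eq_or_left,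
    Set.iInter_iInter_eq_left, Set.mem_inter_iff, Set.mem_preimage, Sum.elim_inl, Sum.elim_inr,
    Set.mem_singleton_iff] at hω
  obtain ⟨hb0, hb1, ha1⟩ := hω
  refine ⟨?_, by rw [ha1]; exact ha⟩
  have ha' : (0 : ℝ) < a := by exact_mod_cast ha
  have hab' : (C : ℝ) < a + b := by exact_mod_cast hab
  simp only [primaryBacklog, primaryCapacity_backlog]
  have h4 := half_le_nextBacklog C (backlog (1 / 2) C (S.initial ω) (fun k => S.primary k ω) 0 0)
    (Nat.cast_nonneg (S.primary 0 ω))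
  rw [← backlog_succ_zero (1 / 2) C (S.initial ω) (fun k => S.primary k ω) 0] at h4
  rw [zero_add, hb0] at h4
  rw [ha1, hb1, ← sub_lt_iff_lt_add', lt_min_iff]
  exact ⟨by linarith, by linarith⟩

/-- Upper bound of the outage probability through the overload events. -/
lemma secondaryOutage_le {S : Traffic.{u} 1 lp ls} {C : ℕ} (hS : S.IsStationary (1 / 2) C)
    (n K : ℕ) {t : ℝ} (ht : 0 ≤ t) :
    S.secondaryOutage (1 / 2) C n ≤
      (K + 1) * Real.exp (-t * (2 * C) +
        (2 * lp * (Real.exp t - 1) + ls * (Real.exp (2 * t) - 1))) +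
      Real.exp (-t * (K * C) + (K + 1) * lp * (Real.exp t - 1)) := by
  -- Moving to slot `K + 1` provides the `K + 1` slots of past that `overload_cases` uses.
  rw [secondaryOutage_eq hS n (K + 1)]
  let E₁ : Set S.Ω := {ω | 2 * (C : ℝ) ≤
    2 * S.secondary (K + 1) ω + S.primary K ω + S.primary (K + 1) ω}
  let E₂ : ℕ → Set S.Ω := fun j => {ω | 2 * (C : ℝ) ≤ S.primary j ω + S.primary (j + 1) ω}
  let E₃ : Set S.Ω := {ω | (K : ℝ) * C ≤ ∑ i ∈ Finset.range (K + 1), (S.primary i ω : ℝ)}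
  set p := Real.exp (-t * (2 * C) + (2 * lp * (Real.exp t - 1) + ls * (Real.exp (2 * t) - 1)))
    with hp
  have h₁ : S.μ.real E₁ ≤ p := by
    have := S.measureReal_le_sum_arrivals {Sum.inr (K + 1), Sum.inl K, Sum.inl (K + 1)}
      (Sum.elim (fun _ => 1) (fun _ => 2)) (2 * C) ht
    simp only [Finset.mem_insert, Finset.mem_singleton, reduceCtorEq, or_self, not_false_eq_true,
      Finset.sum_insert, Sum.inl.injEq, Nat.ne_add_one, Finset.sum_singleton, Sum.elim_inl,
      Sum.elim_inr, one_mul, rate] at this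
    refine (measureReal_mono ?_).trans (this.trans_eq (by rw [hp]; ring_nf))
    intro ω hω
    simp only [E₁, Set.mem_ofPred_eq] at hω ⊢
    linarith
  have h₂ : ∀ j, S.μ.real (E₂ j) ≤ p := by
    intro j
    have := S.measureReal_le_sum_arrivals {Sum.inl j, Sum.inl (j + 1)} (fun _ => 1) (2 * C) ht
    simp only [Finset.mem_singleton, Sum.inl.injEq, Nat.ne_add_one, not_false_eq_true,
      Finset.sum_insert, Finset.sum_singleton, Sum.elim_inl, one_mul, rate] at this
    refine this.trans (Real.exp_le_exp.2 ?_)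
    -- The secondary term only enlarges `p`, so `p` also bounds the purely primary pair events.
    have : 0 ≤ (ls : ℝ) * (Real.exp (2 * t) - 1) :=
      mul_nonneg ls.2 (sub_nonneg.2 (Real.one_le_exp (by linarith)))
    linarith
  have h₃ : S.μ.real E₃ ≤ Real.exp (-t * (K * C) + (K + 1) * lp * (Real.exp t - 1)) := by
    have := S.measureReal_le_sum_arrivals ((Finset.range (K + 1)).map ⟨Sum.inl, Sum.inl_injective⟩)
      (fun _ => 1) (K * C) ht
    simp only [Finset.sum_map, Function.Embedding.coeFn_mk, Sum.elim_inl, one_mul, rate,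
      Finset.sum_const, Finset.card_range, nsmul_eq_mul] at this
    refine this.trans_eq ?_
    push_cast
    ring_nf
  have hsub : {ω | (C : ℝ) < (S.secondary (K + 1) ω : ℝ) + primaryCapacity (1 / 2) C
      (fun i => S.primaryBacklog (1 / 2) C (K + 1) i ω) ∧ 0 < S.secondary (K + 1) ω} ⊆
      (E₁ ∪ ⋃ j ∈ Finset.range K, E₂ j) ∪ E₃ := by
    rintro ω ⟨hω, -⟩
    simp only [primaryBacklog, primaryCapacity_backlog] at hω
    have hω' := hω.trans_le (add_le_add_right (min_le_right _ _) _)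
    rcases overload_cases (x₀ := S.initial ω) (q := fun k => S.primary k ω) (S.initial_nonneg ω) K
      (s := S.secondary (K + 1) ω) (C := C) (by linarith) with h | ⟨j, hj, h⟩ | h
    · exact Or.inl (Or.inl h)
    · exact Or.inl (Or.inr (Set.mem_biUnion hj h))
    · exact Or.inr h
  calc S.secondaryOutage (1 / 2) C (K + 1)
      ≤ S.μ.real ((E₁ ∪ ⋃ j ∈ Finset.range K, E₂ j) ∪ E₃) := measureReal_mono hsub
    _ ≤ (S.μ.real E₁ + ∑ j ∈ Finset.range K, S.μ.real (E₂ j)) + S.μ.real E₃ :=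
        (measureReal_union_le _ _).trans (by
          gcongr
          exact (measureReal_union_le _ _).trans (by
            gcongr; exact measureReal_biUnion_finset_le _ _))
    _ ≤ (p + ∑ j ∈ Finset.range K, p) +
          Real.exp (-t * (K * C) + (K + 1) * lp * (Real.exp t - 1)) := by
        gcongr with j
        exact h₂ j
    _ = _ := by
        rw [Finset.sum_const, Finset.card_range, nsmul_eq_mul]
        ring

end OneSlot

end Traffic

/-! ### Asymptotics of Poisson point masses -/

section PoissonAsymptotics

lemma neg_log_poissonMeasure_singleton {r : ℝ≥0} (hr : 0 < r) (n : ℕ) :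
    -Real.log ((poissonMeasure r).real {n}) =
      r - n * Real.log r + Real.log n.factorial := by
  have hr' : (0 : ℝ) < r := hr
  rw [poissonMeasure_real_singleton, Real.log_div (by positivity) (by positivity),
    Real.log_mul (by positivity) (by positivity), Real.log_exp, Real.log_pow]
  ring

/-- The Stirling sequence decreases from its first value `e / √2`, whose logarithm yields the
constant 1 after `log (2n) / 2` is split. -/
lemma log_factorial_le_stirling {n : ℕ} (hn : n ≠ 0) :
    Real.log n.factorial ≤ n * Real.log n - n + Real.log n / 2 + 1 := by
  obtain ⟨m, rfl⟩ := Nat.exists_eq_succ_of_ne_zero hn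
  have h := Stirling.log_stirlingSeq'_antitone (Nat.zero_le m)
  simp only [Function.comp_apply, Nat.succ_eq_add_one, zero_add, Stirling.stirlingSeq_one] at h
  rw [Stirling.log_stirlingSeq_formula, Real.log_div (by positivity) (by positivity),
    Real.log_mul (by positivity) (by positivity), Real.log_div (by positivity) (by positivity),
    Real.log_exp, Real.log_sqrt (by positivity)] at h
  simp only [Nat.succ_eq_add_one]
  linarith

lemma tendsto_log_natCast_div : Tendsto (fun C : ℕ => Real.log C / C) atTop (𝓝 0) :=
  Real.isLittleO_log_id_atTop.tendsto_div_nhds_zero.comp tendsto_natCast_atTop_atTop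

lemma coe_toNNReal_mul {γ : ℝ} (hγ : 0 < γ) (C : ℕ) :
    ((Real.toNNReal (γ * C) : ℝ≥0) : ℝ) = γ * C := Real.coe_toNNReal _ (by positivity)

lemma coe_toNNReal_rpow (γ : ℝ) (C : ℕ) :
    ((Real.toNNReal ((C : ℝ) ^ γ) : ℝ≥0) : ℝ) = (C : ℝ) ^ γ :=
  Real.coe_toNNReal _ (by positivity)

/-- Large deviation lower bound for the point masses of Poisson distributions with mean `γ C`. -/
lemma exists_neg_log_poisson_linear_le {γ α : ℝ} (hγ : 0 < γ) (hα : 0 < α) {a : ℕ → ℕ}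
    (ha : Tendsto (fun C : ℕ => (a C : ℝ) / C) atTop (𝓝 α)) :
    ∃ U : ℕ → ℝ, (∀ᶠ C : ℕ in atTop,
        -Real.log ((poissonMeasure (Real.toNNReal (γ * C))).real {a C}) / C ≤ U C) ∧
      Tendsto U atTop (𝓝 (γ + α * (Real.log α - Real.log γ) - α)) := by
  have hlog := ha.log hα.ne'
  have hinv : Tendsto (fun C : ℕ => (1 : ℝ) / C) atTop (𝓝 0) := tendsto_one_div_atTop_nhds_zero_nat
  -- Stirling's bound divided by `C`: the `log C` in `log (γ C)` cancels the one in `log (a C)`.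
  refine ⟨fun C => γ + (a C / C) * (Real.log (a C / C) - Real.log γ) - a C / C +
    ((Real.log (a C / C) * (1 / C) + Real.log C / C) / 2 + 1 / C), ?_, ?_⟩
  · filter_upwards [eventually_gt_atTop 0, ha.eventually_const_lt hα] with C hC haC
    have hC' : (0 : ℝ) < C := by exact_mod_cast hC
    have ha' : (0 : ℝ) < a C := by
      by_contra h
      exact haC.not_ge (div_nonpos_of_nonpos_of_nonneg (not_lt.1 h) hC'.le)
    have ha0 : a C ≠ 0 := by rintro h; simp [h] at ha'
    rw [neg_log_poissonMeasure_singleton (Real.toNNReal_pos.2 (by positivity)),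
      coe_toNNReal_mul hγ, Real.log_mul hγ.ne' hC'.ne', Real.log_div ha'.ne' hC'.ne',
      div_le_iff₀ hC']
    have := log_factorial_le_stirling ha0
    field_simp
    linarith
  · have := (((ha.mul (hlog.sub_const (Real.log γ))).const_add γ).sub ha).add
        ((((hlog.mul hinv).add tendsto_log_natCast_div).div_const 2).add hinv)
    simpa using this

/-- Large deviation lower bound for the point masses of Poisson distributions with mean `C ^ γ`. -/
lemma exists_neg_log_poisson_polynomial_le {γ α : ℝ} (hγ : γ < 1) {a : ℕ → ℕ}
    (ha1 : ∀ C, a C ≤ C + 1) (ha : Tendsto (fun C : ℕ => (a C : ℝ) / C) atTop (𝓝 α)) :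
    ∃ U : ℕ → ℝ, (∀ᶠ C : ℕ in atTop,
        -Real.log ((poissonMeasure (Real.toNNReal ((C : ℝ) ^ γ))).real {a C}) /
          (C * Real.log C) ≤ U C) ∧
      Tendsto U atTop (𝓝 (α * (1 - γ))) := by
  have hinv : Tendsto (fun C : ℕ => (Real.log C)⁻¹) atTop (𝓝 0) :=
    (Real.tendsto_log_atTop.comp tendsto_natCast_atTop_atTop).inv_tendsto_atTop
  -- Errors of order `C` vanish at scale `C log C`, so `C ^ γ ≤ C` and the crude `a! ≤ (2C) ^ a`
  -- suffice; this also admits `a C = 0`.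
  refine ⟨fun C => (Real.log C)⁻¹ + (a C / C) * (1 + Real.log 2 * (Real.log C)⁻¹ - γ), ?_, ?_⟩
  · filter_upwards [eventually_gt_atTop 1] with C hC
    have hC' : (1 : ℝ) < C := by exact_mod_cast hC
    have hC0 : (0 : ℝ) < C := by linarith
    have hl := Real.log_pos hC'
    rw [neg_log_poissonMeasure_singleton (Real.toNNReal_pos.2 (by positivity)),
      coe_toNNReal_rpow, Real.log_rpow hC0, div_le_iff₀ (by positivity)]
    have h1 : (C : ℝ) ^ γ ≤ C := by
      simpa using Real.rpow_le_rpow_of_exponent_le hC'.le hγ.le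
    have h2 : Real.log (a C).factorial ≤ a C * (Real.log 2 + Real.log C) := by
      have h3 : ((a C).factorial : ℝ) ≤ (2 * C : ℝ) ^ a C := by
        have : (a C).factorial ≤ (2 * C) ^ a C :=
          (Nat.factorial_le_pow _).trans (Nat.pow_le_pow_left ((ha1 C).trans (by omega)) _)
        exact_mod_cast this
      rw [← Real.log_mul two_ne_zero hC0.ne', ← Real.log_pow]
      exact Real.log_le_log (by positivity) h3
    field_simp
    linarith
  · have := hinv.add (ha.mul (((hinv.const_mul (Real.log 2)).const_add 1).sub_const γ))
    simpa using this

end PoissonAsymptotics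

/-- The gain is determined by an exponential upper bound and by point masses with matching
exponents. -/
lemma tendsto_neg_log_secondaryOutage {lp ls : ℕ → ℝ≥0} {S : (C : ℕ) → Traffic.{u} 1 (lp C) (ls C)}
    (hS : ∀ C, (S C).IsStationary (1 / 2) C) (n K : ℕ) {scale t : ℕ → ℝ} {d vp vs : ℝ}
    {a b : ℕ → ℕ} {Up Us : ℕ → ℝ} (hlp : ∀ᶠ C in atTop, 0 < lp C) (hls : ∀ᶠ C in atTop, 0 < ls C)
    (hscale : Tendsto scale atTop atTop) (ht : ∀ᶠ C in atTop, 0 ≤ t C)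
    (hE : Tendsto (fun C : ℕ => (t C * (2 * C) - (2 * lp C * (Real.exp (t C) - 1) +
      ls C * (Real.exp (2 * t C) - 1))) / scale C) atTop (𝓝 d))
    (hK : ∀ᶠ C : ℕ in atTop, t C * (2 * C) - (2 * lp C * (Real.exp (t C) - 1) +
      ls C * (Real.exp (2 * t C) - 1)) ≤ t C * (K * C) - (K + 1) * lp C * (Real.exp (t C) - 1))
    (ha : ∀ C, 0 < a C) (hab : ∀ᶠ C in atTop, C < a C + b C)
    (hUs : ∀ᶠ C in atTop, -Real.log ((poissonMeasure (ls C)).real {a C}) / scale C ≤ Us C)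
    (hUp : ∀ᶠ C in atTop, -Real.log ((poissonMeasure (lp C)).real {b C}) / scale C ≤ Up C)
    (hvs : Tendsto Us atTop (𝓝 vs)) (hvp : Tendsto Up atTop (𝓝 vp)) (hd : vs + 2 * vp = d) :
    Tendsto (fun C => -Real.log ((S C).secondaryOutage (1 / 2) C n) / scale C) atTop (𝓝 d) := by
  have hlow : Tendsto (fun C : ℕ => (t C * (2 * C) - (2 * lp C * (Real.exp (t C) - 1) +
      ls C * (Real.exp (2 * t C) - 1))) / scale C - Real.log (K + 2) / scale C) atTop (𝓝 d) := by
    simpa using hE.sub (hscale.const_div_atTop (Real.log (K + 2)))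
  have hup : Tendsto (fun C => Us C + 2 * Up C) atTop (𝓝 d) := hd ▸ hvs.add (hvp.const_mul 2)
  have hprod : ∀ᶠ C in atTop, 0 < (poissonMeasure (ls C)).real {a C} ∧
      0 < (poissonMeasure (lp C)).real {b C} := by
    filter_upwards [hlp, hls] with C h1 h2
    exact ⟨poissonMeasure_real_singleton_pos _ h2, poissonMeasure_real_singleton_pos _ h1⟩
  refine tendsto_of_tendsto_of_tendsto_of_le_of_le' hlow hup ?_ ?_
  · filter_upwards [hprod, hab, ht, hK, hscale.eventually_gt_atTop 0] with C ⟨h1, h2⟩ h3 h4 h5 h6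
    have hpos := (mul_pos h1 (pow_pos h2 2)).trans_le
      (Traffic.le_secondaryOutage (hS C) n (ha C) h3)
    have hle := Traffic.secondaryOutage_le (hS C) n K h4
    set E := t C * (2 * C) - (2 * lp C * (Real.exp (t C) - 1) +
      ls C * (Real.exp (2 * t C) - 1)) with hEdef
    -- By `hK` the whole-past event is no likelier than the bound for a pair event; the factor `K +
    -- 2` is lost on dividing its logarithm by `scale`.
    have hle' : (S C).secondaryOutage (1 / 2) C n ≤ (K + 2) * Real.exp (-E) := by
      refine hle.trans ?_
      have e1 : -t C * (2 * C) + (2 * lp C * (Real.exp (t C) - 1) +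
        ls C * (Real.exp (2 * t C) - 1)) = -E := by rw [hEdef]; ring
      have e2 : Real.exp (-t C * (K * C) + (K + 1) * lp C * (Real.exp (t C) - 1)) ≤
        Real.exp (-E) := Real.exp_le_exp.2 (by linarith)
      rw [e1]
      linarith
    have hlog := Real.log_le_log hpos hle'
    rw [Real.log_mul (by positivity) (by positivity), Real.log_exp] at hlog
    rw [← sub_div]
    gcongr
    linarith
  · filter_upwards [hprod, hab, hUs, hUp, hscale.eventually_gt_atTop 0] with C ⟨h1, h2⟩ h3 h4 h5 h6
    have hlog := Real.log_le_log (mul_pos h1 (pow_pos h2 2))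
      (Traffic.le_secondaryOutage (hS C) n (ha C) h3)
    rw [Real.log_mul h1.ne' (pow_pos h2 2).ne', Real.log_pow] at hlog
    rw [div_le_iff₀ h6] at h4 h5 ⊢
    push_cast at hlog
    linarith

/-! ### Linear regime -/

section LinearRegime

variable {γp γs : ℝ}

/-- This is the critical-point equation of the Chernoff exponent in `y = exp t`. It also says that
the tilted means `γs y² C` and `γp y C` add up to `C`. -/
lemma linearRoot_eq (hs : 0 < γs) :
    γs * linearRoot γp γs ^ 2 + γp * linearRoot γp γs = 1 := by
  have h := Real.sq_sqrt (show 0 ≤ 4 * γs + γp ^ 2 by positivity)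
  rw [linearRoot]
  generalize √(4 * γs + γp ^ 2) = r at h
  field_simp
  linear_combination h

lemma one_lt_linearRoot (hs : 0 < γs) (h : γp + γs < 1) :
    1 < linearRoot γp γs := by
  have h1 : γp + 2 * γs < √(4 * γs + γp ^ 2) := Real.lt_sqrt_of_sq_lt (by nlinarith)
  rw [linearRoot, neg_add_eq_sub, ← sub_div, lt_div_iff₀ (by positivity)]
  linarith

/-- The secondary diversity gain in the linear regime. -/
theorem isLinearSecondaryGain (hs : 0 < γs) (hp : 0 < γp) (h : γp + γs < 1) :
    IsLinearSecondaryGain.{u} 1 (1 / 2) γp γs (-γs * (linearRoot γp γs ^ 2 - 1)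
      - 2 * γp * (linearRoot γp γs - 1) + 2 * Real.log (linearRoot γp γs)) := by
  intro S hS n
  have hy := one_lt_linearRoot hs h
  have hroot := linearRoot_eq (γp := γp) hs
  set y := linearRoot γp γs
  have hy0 : 0 < y := by linarith
  set d := -γs * (y ^ 2 - 1) - 2 * γp * (y - 1) + 2 * Real.log y
  have hexp : Real.exp (2 * Real.log y) = y ^ 2 := by
    rw [two_mul, Real.exp_add, Real.exp_log hy0, sq]
  -- This is the exponent gained per congested slot; it is positive because `log y ≥ (y - 1) / y`
  -- and `γp < 1 / y`.
  have hgap : 0 < Real.log y - γp * (y - 1) := by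
    have h1 := Real.one_sub_inv_le_log_of_pos hy0
    have h2 : γp < y⁻¹ := by
      rw [← one_div, lt_div_iff₀ hy0]
      nlinarith [mul_pos hs (pow_pos hy0 2)]
    have h3 : y⁻¹ * (y - 1) = 1 - y⁻¹ := by field_simp
    nlinarith
  -- The extra `γp * (y - 1)` pays for having `K + 1` slots of arrivals against only `K` of
  -- capacity.
  obtain ⟨K, hK⟩ := exists_nat_ge ((d + γp * (y - 1)) / (Real.log y - γp * (y - 1)))
  rw [div_le_iff₀ hgap] at hK
  have hceil : ∀ α : ℝ, 0 < α → Tendsto (fun C : ℕ => (⌈α * C⌉₊ : ℝ) / C) atTop (𝓝 α) :=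
    fun α hα => (tendsto_nat_ceil_mul_div_atTop hα.le).comp tendsto_natCast_atTop_atTop
  have hα : 0 < γs * y ^ 2 := by positivity
  have hβ : 0 < γp * y := by positivity
  -- The added 1 makes both `0 < a` and `C < a + b` hold for every `C`.
  have ha : Tendsto (fun C : ℕ => ((⌈γs * y ^ 2 * C⌉₊ + 1 : ℕ) : ℝ) / C) atTop
      (𝓝 (γs * y ^ 2)) := by
    simpa [add_div] using (hceil _ hα).add tendsto_one_div_atTop_nhds_zero_nat
  obtain ⟨Us, hUs, hvs⟩ := exists_neg_log_poisson_linear_le hs hα ha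
  obtain ⟨Up, hUp, hvp⟩ := exists_neg_log_poisson_linear_le hp hβ (hceil _ hβ)
  have hpos : ∀ γ : ℝ, 0 < γ → ∀ᶠ C : ℕ in atTop, 0 < Real.toNNReal (γ * C) := fun γ hγ => by
    filter_upwards [eventually_gt_atTop 0] with C hC
    exact Real.toNNReal_pos.2 (by positivity)
  refine tendsto_neg_log_secondaryOutage hS n K (t := fun _ => Real.log y) (hpos _ hp) (hpos _ hs)
    tendsto_natCast_atTop_atTop (Eventually.of_forall fun _ => Real.log_nonneg hy.le) ?_ ?_
    (fun _ => Nat.succ_pos _) (Eventually.of_forall fun C => ?_) hUs hUp hvs hvp ?_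
  · refine tendsto_const_nhds.congr' ?_
    filter_upwards [eventually_gt_atTop 0] with C hC
    have hC' : (C : ℝ) ≠ 0 := by positivity
    rw [coe_toNNReal_mul hp, coe_toNNReal_mul hs, hexp, Real.exp_log hy0, eq_div_iff hC']
    ring
  · refine Eventually.of_forall fun C => ?_
    rw [coe_toNNReal_mul hp, coe_toNNReal_mul hs, hexp, Real.exp_log hy0]
    have := mul_le_mul_of_nonneg_right hK (Nat.cast_nonneg (α := ℝ) C)
    linear_combination this
  · have h1 := Nat.le_ceil (γs * y ^ 2 * C)
    have h2 := Nat.le_ceil (γp * y * C)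
    have h3 : (C : ℝ) < ((⌈γs * y ^ 2 * C⌉₊ + 1 + ⌈γp * y * C⌉₊ : ℕ) : ℝ) := by
      push_cast
      have : (C : ℝ) = γs * y ^ 2 * C + γp * y * C := by rw [← add_mul, hroot, one_mul]
      linarith
    exact_mod_cast h3
  -- The logarithmic costs sum to `2 (γs y² + γp y) log y`, which is `2 log y` by the root equation.
  · rw [Real.log_mul hs.ne' (by positivity), Real.log_mul hp.ne' hy0.ne', Real.log_pow]
    push_cast
    linear_combination (2 * Real.log y) * hroot

end LinearRegime

/-! ### Polynomial regime -/

section PolynomialRegime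

/-- The secondary diversity gain in the polynomial regime. -/
theorem isPolynomialSecondaryGain {γp γs : ℝ} (hp : γp < 1) (hs : γs < 1) :
    IsPolynomialSecondaryGain.{u} 1 (1 / 2) γp γs (min (1 - γs) (2 * (1 - γp))) := by
  intro S hS n
  set d := min (1 - γs) (2 * (1 - γp)) with hd
  have hd0 : 0 < d := lt_min (by linarith) (by linarith)
  have hd1 : d ≤ 1 - γs := min_le_left _ _
  have hd2 : d ≤ 2 * (1 - γp) := min_le_right _ _
  have hlog : Tendsto (fun C : ℕ => Real.log C) atTop atTop :=
    Real.tendsto_log_atTop.comp tendsto_natCast_atTop_atTop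
  have hscale : Tendsto (fun C : ℕ => C * Real.log C) atTop atTop :=
    tendsto_natCast_atTop_atTop.atTop_mul_atTop₀ hlog
  have hpos : ∀ γ : ℝ, ∀ᶠ C : ℕ in atTop, 0 < Real.toNNReal ((C : ℝ) ^ γ) := fun γ => by
    filter_upwards [eventually_gt_atTop 0] with C hC
    exact Real.toNNReal_pos.2 (by positivity)
  have hterm : ∀ γ τ : ℝ, 0 ≤ τ → γ + τ ≤ 1 → ∀ C : ℕ, 0 < C →
      0 ≤ (Real.toNNReal ((C : ℝ) ^ γ)) * (Real.exp (τ * Real.log C) - 1) ∧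
      (Real.toNNReal ((C : ℝ) ^ γ)) * (Real.exp (τ * Real.log C) - 1) ≤ C := by
    intro γ τ hτ hγτ C hC
    have hC' : (0 : ℝ) < C := by exact_mod_cast hC
    have hC1 : (1 : ℝ) ≤ C := by exact_mod_cast hC
    have h1 : Real.exp (τ * Real.log C) = (C : ℝ) ^ τ := by
      rw [Real.rpow_def_of_pos hC', mul_comm]
    have h2 : (C : ℝ) ^ γ * (C : ℝ) ^ τ ≤ C := by
      rw [← Real.rpow_add hC']
      simpa using Real.rpow_le_rpow_of_exponent_le hC1 hγτ
    have h3 : 0 ≤ (C : ℝ) ^ γ := by positivity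
    rw [coe_toNNReal_rpow, h1]
    exact ⟨mul_nonneg h3 (sub_nonneg.2 (Real.one_le_rpow hC1 hτ)), by linarith⟩
  -- With `exp t = C ^ (d / 2)`, the constraints `γp + d / 2 ≤ 1` and `γs + d ≤ 1` keep the Poisson
  -- terms below `C`; the largest such `d` is the minimum.
  have htp := hterm γp (d / 2) (by linarith) (by linarith)
  have hts := hterm γs (2 * (d / 2)) (by linarith) (by linarith)
  -- The cost is linear in `(α, β)`, so the cheapest overload is extreme: all secondary, or all
  -- primary apart from the one secondary request an outage requires.
  obtain ⟨a, b, α, β, ha0, hab, ha1, hb1, ha, hb, hαβ⟩ : ∃ (a b : ℕ → ℕ) (α β : ℝ),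
      (∀ C, 0 < a C) ∧ (∀ C, C < a C + b C) ∧ (∀ C, a C ≤ C + 1) ∧ (∀ C, b C ≤ C + 1) ∧
      Tendsto (fun C : ℕ => (a C : ℝ) / C) atTop (𝓝 α) ∧
      Tendsto (fun C : ℕ => (b C : ℝ) / C) atTop (𝓝 β) ∧
      α * (1 - γs) + 2 * (β * (1 - γp)) = d := by
    have h0 : Tendsto (fun C : ℕ => (1 : ℝ) / C) atTop (𝓝 0) := tendsto_one_div_atTop_nhds_zero_nat
    have h1 : Tendsto (fun C : ℕ => (C : ℝ) / C) atTop (𝓝 1) := by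
      refine tendsto_const_nhds.congr' ?_
      filter_upwards [eventually_gt_atTop 0] with C hC
      rw [div_self (by positivity)]
    rcases le_total (1 - γs) (2 * (1 - γp)) with h | h
    · refine ⟨fun C => C + 1, fun _ => 0, 1, 0, fun _ => by simp, fun _ => by simp, fun _ => le_rfl,
        fun _ => by simp, ?_, by simp, by rw [hd, min_eq_left h]; ring⟩
      simpa [add_div] using h1.add h0
    · refine ⟨fun _ => 1, fun C => C, 0, 1, fun _ => by simp, fun _ => by simp, fun _ => by simp,
        fun _ => by simp, by simpa using h0, h1, by rw [hd, min_eq_right h]; ring⟩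
  obtain ⟨Us, hUs, hvs⟩ := exists_neg_log_poisson_polynomial_le hs ha1 ha
  obtain ⟨Up, hUp, hvp⟩ := exists_neg_log_poisson_polynomial_le hp hb1 hb
  refine tendsto_neg_log_secondaryOutage hS n 3 (t := fun C => d / 2 * Real.log C)
    (hpos _) (hpos _) hscale ?_ ?_ ?_ ha0 (Eventually.of_forall hab) hUs hUp hvs hvp hαβ
  · filter_upwards [hlog.eventually_ge_atTop 0] with C hC
    positivity
  -- The 3 counts two primary terms and one secondary term, each at most `C`.
  · have h1 : Tendsto (fun C : ℕ => d - 3 / Real.log C) atTop (𝓝 d) := by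
      simpa using (hlog.const_div_atTop 3).const_sub d
    refine tendsto_of_tendsto_of_tendsto_of_le_of_le' h1 tendsto_const_nhds ?_ ?_
    · filter_upwards [hlog.eventually_gt_atTop 0, eventually_gt_atTop 0] with C hl hC
      have hC' : (0 : ℝ) < C := by exact_mod_cast hC
      rw [le_div_iff₀ (by positivity)]
      have e : (d - 3 / Real.log C) * (C * Real.log C) = d * C * Real.log C - 3 * C := by
        field_simp
      rw [e, ← mul_assoc 2 (d / 2)]
      linarith [(htp C hC).2, (hts C hC).2]
    · filter_upwards [hlog.eventually_gt_atTop 0, eventually_gt_atTop 0] with C hl hC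
      have hC' : (0 : ℝ) < C := by exact_mod_cast hC
      rw [div_le_iff₀ (by positivity), ← mul_assoc 2 (d / 2)]
      linarith [(htp C hC).1, (hts C hC).1]
  -- With `K = 3` there is a surplus `t C` over `2 t C`; from `log C ≥ 8 / d` on it is at least
  -- `4C`, which covers the four primary terms.
  · filter_upwards [hlog.eventually_ge_atTop (8 / d), eventually_gt_atTop 0] with C hl hC
    rw [div_le_iff₀ hd0] at hl
    have h1 := mul_le_mul_of_nonneg_right hl (Nat.cast_nonneg (α := ℝ) C)
    rw [← mul_assoc 2 (d / 2)]
    push_cast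
    linarith [(htp C hC).2, (hts C hC).1, (htp C hC).1]

end PolynomialRegime

end ProactiveNetwork

theorem mainTheorem4 :
    (∀ γp γs : ℝ, 0 < γs → γs < γp → γp + γs < 1 →
      ∃ d : ℝ, ProactiveNetwork.IsLinearSecondaryGain.{u} 1 (1 / 2) γp γs d ∧
        -γs * (ProactiveNetwork.linearRoot γp γs ^ 2 - 1)
          - 2 * γp * (ProactiveNetwork.linearRoot γp γs - 1)
          + 2 * Real.log (ProactiveNetwork.linearRoot γp γs) ≤ d) ∧
    (∀ γp γs : ℝ, 0 < γs → γs < γp → γp < 1 →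
      ∃ d : ℝ, ProactiveNetwork.IsPolynomialSecondaryGain.{u} 1 (1 / 2) γp γs d ∧
        (2 * γp ≤ 1 + γs → 1 - γs ≤ d) ∧
        (1 + γs < 2 * γp → 2 * (1 - γp) ≤ d)) := by
  refine ⟨fun γp γs hs hsp h => ⟨_, ProactiveNetwork.isLinearSecondaryGain hs (hs.trans hsp) h,
    le_rfl⟩, fun γp γs hs hsp hp => ⟨_, ProactiveNetwork.isPolynomialSecondaryGain hp
      (hsp.trans hp), fun h => le_min le_rfl ?_, fun h => le_min ?_ le_rfl⟩⟩ <;> linarith
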